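/- Let $\Phi$ be a finite crystallographic root system in a real vector space, with (finite) Weyl group $W$, not necessarily simple, and let $\Lambda_a=\mathbb Z\Phi$ be its root lattice. The semidirect product $W^+=W\ltimes\Lambda_a$ (an affine Weyl group) acts on the ambient space, $W$ linearly and $\Lambda_a$ by translations. Let $v\in\mathbb R\Lambda_a$ and let $$W^{v+\Lambda_a}=\{\rho\in W : \rho(v)-v\in\Lambda_a\}.$$ Then $W^{v+\Lambda_a}$ is isomorphic to a finite parabolic subgroup of $W^+$, namely to the stabilizer $(W^+)^v$ of $v$ in $W^+$. In detail: 1. There is an isomorphism $W^{v+\Lambda_a}\to(W^+)^v$ that sends each $\rho$ to an element of $W^+$ whose linear part (its image under the projection $W^+\to W$) is $\rho$. 2. The group $(W^+)^v$ is finite, and it is generated by the affine reflections $x\mapsto x-(\langle x,\alpha^\vee\rangle-k)\alpha$ with $\alpha\in\Phi$, $k\in\mathbb Z$ that it contains. 3. The group $(W^+)^v$ is a parabolic subgroup of $W^+$. That is, alcoves exist (chambers of the arrangement of all the hyperplanes $\langle x,\alpha^\vee\rangle=k$ with $\alpha\in\Phi$, $k\in\mathbb Z$), and for every alcove $C$,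 with $S_C\subset W^+$ the set of reflections in the walls of $C$, the group $(W^+)^v$ is conjugate in $W^+$ to the subgroup generated by some subset of $S_C$. -/

import Mathlib

noncomputable section

namespace RootPairing

variable {ι M N : Type*} [AddCommGroup M] [Module ℝ M] [AddCommGroup N] [Module ℝ N]
  (P : RootPairing ι ℝ M N)

/-- The root lattice: the additive group generated by the roots. -/
def rootLattice : AddSubgroup M :=
  AddSubgroup.closure (Set.range P.root)

theorem root_mem_rootLattice (i : ι) : P.root i ∈ P.rootLattice :=
  AddSubgroup.subset_closure (Set.mem_range_self i)

/-- The Weyl group preserves the root lattice. -/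
theorem smul_mem_rootLattice (w : P.weylGroup) {x : M} (hx : x ∈ P.rootLattice) :
    w • x ∈ P.rootLattice := by
  induction hx using AddSubgroup.closure_induction with
  | mem x hx =>
    obtain ⟨i, rfl⟩ := hx
    rw [P.weylGroup_apply_root w i]
    exact P.root_mem_rootLattice _
  | zero => simp
  | add x y _ _ hx hy => rw [smul_add]; exact add_mem hx hy
  | neg x _ hx => rw [smul_neg]; exact neg_mem hx

/-- The congruence subgroup: the elements `ρ` of the Weyl group such that `ρ v - v` lies in
the root lattice. -/
def congruenceSubgroup (v : M) : Subgroup P.weylGroup where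
  carrier := {ρ | ρ • v - v ∈ P.rootLattice}
  one_mem' := by simp
  mul_mem' := by
    intro a b ha hb
    have h : (a * b) • v - v = a • (b • v - v) + (a • v - v) := by
      rw [mul_smul, smul_sub]; abel
    change (a * b) • v - v ∈ P.rootLattice
    rw [h]
    exact add_mem (P.smul_mem_rootLattice a hb) ha
  inv_mem' := by
    intro a ha
    have h : a⁻¹ • v - v = -(a⁻¹ • (a • v - v)) := by
      rw [smul_sub, inv_smul_smul]; abel
    change a⁻¹ • v - v ∈ P.rootLattice
    rw [h]
    exact neg_mem (P.smul_mem_rootLattice a⁻¹ ha)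

/-- The action of the Weyl group on the root lattice, the latter written multiplicatively. -/
def latticeAction : P.weylGroup →* MulAut (Multiplicative P.rootLattice) where
  toFun w :=
    { toFun := fun l => Multiplicative.ofAdd
        ⟨w • (l.toAdd : M), P.smul_mem_rootLattice w l.toAdd.2⟩
      invFun := fun l => Multiplicative.ofAdd
        ⟨w⁻¹ • (l.toAdd : M), P.smul_mem_rootLattice w⁻¹ l.toAdd.2⟩
      left_inv := fun l => Subtype.ext (inv_smul_smul w (l.toAdd : M))
      right_inv := fun l => Subtype.ext (smul_inv_smul w (l.toAdd : M))
      map_mul' := fun l m => Subtype.ext (smul_add w (l.toAdd : M) (m.toAdd : M)) }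
  map_one' := by
    refine MulEquiv.ext fun l => ?_
    exact Subtype.ext (one_smul _ (l.toAdd : M))
  map_mul' a b := by
    refine MulEquiv.ext fun l => ?_
    exact Subtype.ext (mul_smul a b (l.toAdd : M))

/-- The affine Weyl group, the semidirect product of the Weyl group and the root lattice. -/
abbrev AffineWeylGroup : Type _ :=
  Multiplicative P.rootLattice ⋊[P.latticeAction] P.weylGroup

/-- The affine Weyl group acts on the ambient space: the root lattice by translations, and the
Weyl group linearly. -/
instance affineWeylAction : MulAction P.AffineWeylGroup M where
  smul g x := g.right • x + (g.left.toAdd : M)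
  one_smul x := by
    change (1 : P.weylGroup) • x + (0 : M) = x
    rw [one_smul, add_zero]
  mul_smul g h x := by
    change (g.right * h.right) • x + ((g.left.toAdd : M) + g.right • (h.left.toAdd : M)) =
      g.right • (h.right • x + (h.left.toAdd : M)) + (g.left.toAdd : M)
    rw [mul_smul, smul_add]
    abel

theorem affineWeyl_smul_def (g : P.AffineWeylGroup) (x : M) :
    g • x = g.right • x + (g.left.toAdd : M) := rfl

/-- The affine hyperplane on which the coroot with index `i` takes the value `k`. -/
def affineHyperplane (i : ι) (k : ℤ) : Set M :=
  {x | P.coroot' i x = k}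

/-- The affine reflection `x ↦ s x + k α`, where `α` is the root with index `i` and `s` is its
reflection. -/
def affineReflection (i : ι) (k : ℤ) : P.AffineWeylGroup :=
  ⟨Multiplicative.ofAdd ⟨k • P.root i, zsmul_mem (P.root_mem_rootLattice i) k⟩,
    weylGroup.ofIdx P i⟩

theorem affineReflection_smul (i : ι) (k : ℤ) (x : M) :
    P.affineReflection i k • x = x - (P.coroot' i x - k) • P.root i := by
  have h : P.affineReflection i k • x = P.reflection i x + k • P.root i := rfl
  rw [h, P.reflection_apply, sub_smul, Int.cast_smul_eq_zsmul]
  abel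

/-- The points `x` and `y` lie strictly on the same side of the affine hyperplane. -/
def StrictlySameSide (i : ι) (k : ℤ) (x y : M) : Prop :=
  0 < (P.coroot' i x - k) * (P.coroot' i y - k)

/-- An alcove (a chamber of the affine Weyl group): the set of all points which lie strictly on
the same side as `a` of every affine hyperplane, for some point `a` on no affine hyperplane. -/
def IsAlcove (C : Set M) : Prop :=
  ∃ a : M, (∀ i k, a ∉ P.affineHyperplane i k) ∧ C = {x | ∀ i k, P.StrictlySameSide i k x a}

/-- The affine hyperplane with index `(i, k)` is a wall of the alcove `C`, that is, it supports a
face of `C`: some point of it lies on no other affine hyperplane, and lies on the same side as `C`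
of all the other ones. -/
def IsWall (C : Set M) (i : ι) (k : ℤ) : Prop :=
  ∃ x ∈ P.affineHyperplane i k, ∀ j l, P.affineHyperplane j l ≠ P.affineHyperplane i k →
    ∀ c ∈ C, P.StrictlySameSide j l x c

/-- The Coxeter generators of the affine Weyl group attached to an alcove: the reflections in its
walls. -/
def wallReflections (C : Set M) : Set P.AffineWeylGroup :=
  {s | ∃ i k, P.IsWall C i k ∧ s = P.affineReflection i k}

/-- A subgroup of the affine Weyl group is parabolic, with respect to the Coxeter generators
attached to `C`, if it is conjugate to a subgroup generated by some of these generators. -/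
def IsParabolic (C : Set M) (H : Subgroup P.AffineWeylGroup) : Prop :=
  ∃ J ⊆ P.wallReflections C, ∃ g : P.AffineWeylGroup,
    H = (Subgroup.closure J).map (MulAut.conj g).toMonoidHom

end RootPairing

end

noncomputable section

/-! An element with linear part `ρ` fixes `v` exactly when its translation part is `v - ρ v`. Taking
linear parts therefore identifies the stabilizer with the congruence subgroup, and finiteness
follows from that of the Weyl group.

The parabolic statement is the classical argument with alcoves. Coroots are integral on the root
lattice, so the affine Weyl group permutes the affine hyperplanes. Fix `a` on none of them and
measure the distance from `x` to the alcove of `a` by the hyperplanes separating `x` from `a`. If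
there are any, one is a wall (`exists_wall_separating`), and reflecting in it lowers the count
(`ncard_separating_affineRefl_lt`).

Descent on this count moves every point into the closed alcove and, applied to a generic point of a
hyperplane, shows that the wall reflections generate the group. With the exchange property, only the
identity maps the alcove to itself. A last descent shows that the stabilizer of a point of the
closed alcove is generated by the wall reflections fixing it (`mem_closure_of_smul_eq`); conjugation
carries this to every `v`. -/

/-! ### Facets of finite systems of linear inequalities. -/

/-- A functional vanishing on the kernel of a nonzero functional is a multiple of it. -/
theorem Module.Dual.exists_eq_smul_of_ker_le {M : Type*} [AddCommGroup M] [Module ℝ M]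
    {f g : Module.Dual ℝ M} (hf : f ≠ 0) (h : ∀ x, f x = 0 → g x = 0) :
    ∃ c : ℝ, g = c • f := by
  obtain ⟨u, hu⟩ : ∃ u, f u ≠ 0 := by
    by_contra! hc
    exact hf (LinearMap.ext hc)
  refine ⟨g u / f u, LinearMap.ext fun x => ?_⟩
  have := h (x - (f x / f u) • u) (by simp [hu])
  simp only [map_sub, map_smul, smul_eq_mul] at this
  simp only [LinearMap.smul_apply, smul_eq_mul]
  field_simp at this ⊢
  linarith

/-- A point outside a polyhedron with nonempty interior is cut off by a facet: a bounding
hyperplane with a point which is in the interior of all the half-spaces not bounded by it. -/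
theorem exists_facet_separating {M κ : Type*} [AddCommGroup M] [Module ℝ M] (T : Finset κ)
    (φ : κ → Module.Dual ℝ M) (c : κ → ℝ) (hφ : ∀ j ∈ T, φ j ≠ 0)
    {a x : M} (ha : ∀ j ∈ T, c j < φ j a) (hx : ∃ j ∈ T, φ j x < c j) :
    ∃ i ∈ T, φ i x < c i ∧ ∃ p, φ i p = c i ∧
      ∀ j ∈ T, c j < φ j p ∨ ∃ r : ℝ, r ≠ 0 ∧ φ j = r • φ i ∧ c j = r * c i := by
  classical
  -- An irredundant subsystem with the same strict solutions; its members define the facets.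
  obtain ⟨S, ⟨hST, hS⟩, hmin⟩ : ∃ S, Minimal (fun S : Finset κ => S ⊆ T ∧
      ∀ y, (∀ j ∈ S, c j < φ j y) → ∀ j ∈ T, c j < φ j y) S :=
    exists_minimal_of_wellFoundedLT _ ⟨T, subset_rfl, fun y hy => hy⟩
  -- If `φ j y < c j`, the segment from `y` to `a` meets `φ j = c j` at a point satisfying `S`
  -- strictly, which is impossible.
  have closed : ∀ y, (∀ j ∈ S, c j ≤ φ j y) → ∀ j ∈ T, c j ≤ φ j y := by
    intro y hy j hj
    by_contra! hlt
    have haj := ha j hj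
    have hd : 0 < φ j a - φ j y := by linarith
    set t := (c j - φ j y) / (φ j a - φ j y) with ht
    have ht0 : 0 < t := div_pos (by linarith) hd
    have ht1 : t < 1 := (div_lt_one hd).2 (by linarith)
    have := hS (y + t • (a - y)) (fun i hi => by
      simp only [map_add, map_smul, map_sub, smul_eq_mul]
      nlinarith [hy i hi, ha i (hST hi)]) j hj
    simp only [map_add, map_smul, map_sub, smul_eq_mul, ht] at this
    rw [div_mul_cancel₀ _ hd.ne'] at this
    linarith
  obtain ⟨i, hiS, hix⟩ : ∃ i ∈ S, φ i x < c i := by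
    by_contra! hc
    obtain ⟨j, hj, hjx⟩ := hx
    exact absurd (closed x hc j hj) (not_le.2 hjx)
  have hiT := hST hiS
  refine ⟨i, hiT, hix, ?_⟩
  -- By irredundancy some `y` violates only the inequality `i`; the point `p` is where the segment
  -- from `y` to `a` crosses its hyperplane.
  obtain ⟨y, hy, hyi⟩ : ∃ y, (∀ j ∈ S.erase i, c j < φ j y) ∧ φ i y ≤ c i := by
    by_contra! hc
    have hsub := hmin ⟨(S.erase_subset i).trans hST, fun y hy => hS y fun j hj => by
      by_cases hji : j = i
      · exact hji ▸ hc y hy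
      · exact hy j (Finset.mem_erase.2 ⟨hji, hj⟩)⟩ (S.erase_subset i)
    exact Finset.notMem_erase i S (hsub hiS)
  have hai := ha i hiT
  have hd : 0 < φ i a - φ i y := by linarith
  set t := (c i - φ i y) / (φ i a - φ i y) with ht
  have ht0 : 0 ≤ t := div_nonneg (by linarith) hd.le
  have ht1 : t < 1 := (div_lt_one hd).2 (by linarith)
  set p := y + t • (a - y) with hp
  have hpi : φ i p = c i := by
    simp only [hp, map_add, map_smul, map_sub, smul_eq_mul, ht]
    rw [div_mul_cancel₀ _ hd.ne']
    ring
  have hpS : ∀ j ∈ S, j ≠ i → c j < φ j p := fun j hj hji => by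
    have h1 := hy j (Finset.mem_erase.2 ⟨hji, hj⟩)
    have h2 := ha j (hST hj)
    simp only [hp, map_add, map_smul, map_sub, smul_eq_mul]
    nlinarith
  have hpT := closed p fun j hj => by
    by_cases hji : j = i
    · rw [hji, hpi]
    · exact (hpS j hj hji).le
  refine ⟨p, hpi, fun j hj => (hpT j hj).lt_or_eq.imp_right fun hjp => ?_⟩
  -- Otherwise a small move from `p` along `u` satisfies `S` strictly while keeping `φ j` equal to
  -- `c j`.
  have hker : ∀ u, φ j u = 0 → φ i u ≤ 0 := by
    intro u hu
    by_contra! hiu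
    have hev : ∃ ε : ℝ, 0 < ε ∧ ∀ l ∈ S, c l < φ l (p + ε • u) := by
      have : ∀ᶠ ε in nhdsWithin (0 : ℝ) (Set.Ioi 0), ∀ l ∈ S, c l < φ l (p + ε • u) := by
        rw [Filter.eventually_all_finset]
        intro l hl
        simp only [map_add, map_smul, smul_eq_mul]
        by_cases hli : l = i
        · filter_upwards [self_mem_nhdsWithin] with ε hε
          rw [hli, hpi]
          have : 0 < ε * φ i u := mul_pos hε hiu
          linarith
        · have hcont : Filter.Tendsto (fun ε : ℝ => φ l p + ε * φ l u) (nhds 0)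
              (nhds (φ l p + 0 * φ l u)) := by
            apply Continuous.tendsto
            fun_prop
          refine (hcont.mono_left nhdsWithin_le_nhds).eventually_const_lt ?_
          simpa using hpS l hl hli
      obtain ⟨ε, h1, h2⟩ := (this.and self_mem_nhdsWithin).exists
      exact ⟨ε, h2, h1⟩
    obtain ⟨ε, -, hε⟩ := hev
    have := hS _ hε j hj
    simp [hu, ← hjp] at this
  have hker' : ∀ u, φ j u = 0 → φ i u = 0 := fun u hu =>
    le_antisymm (hker u hu) (by simpa using hker (-u) (by simp [hu]))
  obtain ⟨r, hr⟩ := Module.Dual.exists_eq_smul_of_ker_le (hφ j hj) hker'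
  have hr0 : r ≠ 0 := by
    rintro rfl
    exact hφ i hiT (by simpa using hr)
  have hji : φ j = r⁻¹ • φ i := by rw [hr, smul_smul, inv_mul_cancel₀ hr0, one_smul]
  refine ⟨r⁻¹, inv_ne_zero hr0, hji, ?_⟩
  rw [hjp, hji, ← hpi]
  rfl

/-! ### Affine hyperplanes and reflections. -/

namespace RootPairing

variable {ι M N : Type*} [AddCommGroup M] [Module ℝ M] [AddCommGroup N] [Module ℝ N]
  (P : RootPairing ι ℝ M N)

/-- The affine function whose zero set is the affine hyperplane with index `h`. -/
def affineValue (h : ι × ℤ) (x : M) : ℝ := P.coroot' h.1 x - h.2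

theorem coroot'_ne_zero (i : ι) : P.coroot' i ≠ 0 := by
  intro h
  have := LinearMap.congr_fun h (P.root i)
  simp at this

theorem exists_int_coroot'_eq [P.IsCrystallographic] (i : ι) {x : M} (hx : x ∈ P.rootLattice) :
    ∃ n : ℤ, P.coroot' i x = n := by
  induction hx using AddSubgroup.closure_induction with
  | mem x hx =>
    obtain ⟨j, rfl⟩ := hx
    exact ⟨P.pairingIn ℤ j i, by
      rw [P.root_coroot'_eq_pairing, ← P.algebraMap_pairingIn ℤ]; rfl⟩
  | zero => exact ⟨0, by simp⟩
  | add x y _ _ hx hy =>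
    obtain ⟨n, hn⟩ := hx
    obtain ⟨m, hm⟩ := hy
    exact ⟨n + m, by rw [map_add, hn, hm]; simp⟩
  | neg x _ hx =>
    obtain ⟨n, hn⟩ := hx
    exact ⟨-n, by rw [map_neg, hn]; simp⟩

theorem weylGroup_ext {v w : P.weylGroup} (h : ∀ x : M, v • x = w • x) : v = w := by
  apply Subtype.ext
  apply Equiv.weightHom_injective P
  exact LinearEquiv.ext h

theorem affineWeylGroup_ext {g h : P.AffineWeylGroup} (H : ∀ x : M, g • x = h • x) : g = h := by
  have h0 : (g.left.toAdd : M) = h.left.toAdd := by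
    simpa [affineWeyl_smul_def] using H 0
  refine SemidirectProduct.ext (Subtype.ext h0) (P.weylGroup_ext fun x => ?_)
  have := H x
  rw [affineWeyl_smul_def, affineWeyl_smul_def, h0] at this
  exact add_right_cancel this

theorem coroot'_weylGroupToPerm_smul (w : P.weylGroup) (i : ι) (x : M) :
    P.coroot' (P.weylGroupToPerm w i) (w • x) = P.coroot' i x := by
  obtain ⟨w, hw⟩ := w
  revert i x
  induction hw using weylGroup.induction with
  | mem j =>
    intro i x
    change P.coroot' (P.reflectionPerm j i) (P.reflection j x) = _
    rw [P.coroot'_reflectionPerm]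
    simp
  | one => intro i x; rfl
  | mul g₁ g₂ hg₁ hg₂ h₁ h₂ =>
    intro i x
    exact (h₁ _ _).trans (h₂ i x)

/-- The affine reflection with the given index. -/
def affineRefl (h : ι × ℤ) : P.AffineWeylGroup := P.affineReflection h.1 h.2

theorem affineRefl_smul (h : ι × ℤ) (x : M) :
    P.affineRefl h • x = x - P.affineValue h x • P.root h.1 :=
  P.affineReflection_smul _ _ _

theorem affineValue_affineRefl (h : ι × ℤ) (x : M) :
    P.affineValue h (P.affineRefl h • x) = -P.affineValue h x := by
  rw [affineRefl_smul]
  simp only [affineValue, map_sub, map_smul, smul_eq_mul, root_coroot'_eq_pairing, pairing_same]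
  ring

theorem affineRefl_smul_smul (h : ι × ℤ) (x : M) :
    P.affineRefl h • P.affineRefl h • x = x := by
  rw [affineRefl_smul, affineValue_affineRefl, affineRefl_smul]
  simp

theorem affineRefl_mul_self (h : ι × ℤ) : P.affineRefl h * P.affineRefl h = 1 :=
  P.affineWeylGroup_ext fun x => by rw [mul_smul, affineRefl_smul_smul, one_smul]

/-- The linear part permutes the coroots, and the translation part shifts the level by an integer,
by crystallographicity. -/
theorem exists_affineValue_smul [P.IsCrystallographic] (g : P.AffineWeylGroup) (h : ι × ℤ) :
    ∃ h' : ι × ℤ, (∀ x, P.affineValue h' (g • x) = P.affineValue h x) ∧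
      g * P.affineRefl h * g⁻¹ = P.affineRefl h' := by
  obtain ⟨n, hn⟩ := P.exists_int_coroot'_eq (P.weylGroupToPerm g.right h.1) g.left.toAdd.2
  have key : ∀ x, P.affineValue (P.weylGroupToPerm g.right h.1, h.2 + n) (g • x) =
      P.affineValue h x := fun x => by
    simp only [affineValue]
    rw [affineWeyl_smul_def, map_add, P.coroot'_weylGroupToPerm_smul, hn]
    push_cast
    ring
  refine ⟨_, key, ?_⟩
  rw [mul_inv_eq_iff_eq_mul]
  refine P.affineWeylGroup_ext fun x => ?_
  rw [mul_smul, mul_smul, affineRefl_smul, affineRefl_smul, key, affineWeyl_smul_def,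
    affineWeyl_smul_def, smul_sub, smul_comm g.right, ← P.weylGroup_apply_root]
  abel

theorem mem_affineHyperplane_iff (h : ι × ℤ) (x : M) :
    x ∈ P.affineHyperplane h.1 h.2 ↔ P.affineValue h x = 0 :=
  sub_eq_zero.symm

theorem exists_eq_mul_of_affineHyperplane_eq {h h' : ι × ℤ}
    (H : P.affineHyperplane h'.1 h'.2 = P.affineHyperplane h.1 h.2) :
    ∃ c : ℝ, c ≠ 0 ∧ ∀ x, P.affineValue h' x = c * P.affineValue h x := by
  have hiff : ∀ x, P.affineValue h' x = 0 ↔ P.affineValue h x = 0 := fun x => by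
    rw [← mem_affineHyperplane_iff, ← mem_affineHyperplane_iff, H]
  -- A point of the hyperplane, since a coroot takes the value 2 on its own root.
  set p : M := ((h.2 : ℝ) / 2) • P.root h.1
  have hp : P.affineValue h p = 0 := by simp [affineValue, p]
  have hp' := (hiff p).2 hp
  have hadd : ∀ (l : ι × ℤ) x, P.affineValue l (p + x) = P.affineValue l p + P.coroot' l.1 x :=
    fun l x => by simp only [affineValue, map_add]; ring
  obtain ⟨c, hc⟩ := Module.Dual.exists_eq_smul_of_ker_le (P.coroot'_ne_zero h.1)
    (g := P.coroot' h'.1) fun x hx => by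
      have h1 := (hiff (p + x)).2 (by rw [hadd, hp, hx, add_zero])
      rwa [hadd, hp', zero_add] at h1
  refine ⟨c, ?_, fun x => ?_⟩
  · rintro rfl
    exact P.coroot'_ne_zero h'.1 (by simpa using hc)
  · have h1 := hadd h (x - p)
    have h2 := hadd h' (x - p)
    rw [hp, zero_add, add_sub_cancel] at h1
    rw [hp', zero_add, add_sub_cancel, hc] at h2
    rw [h2, h1]
    rfl

theorem affineHyperplane_eq_of_eq_mul {h h' : ι × ℤ} {c : ℝ} (hc : c ≠ 0)
    (H : ∀ x, P.affineValue h' x = c * P.affineValue h x) :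
    P.affineHyperplane h'.1 h'.2 = P.affineHyperplane h.1 h.2 := by
  ext x
  rw [mem_affineHyperplane_iff, mem_affineHyperplane_iff, H]
  simp [hc]

/-- Distinct indices may give one hyperplane: opposite roots do, and so do proportional roots when
the system is not reduced. Scaling the coroot by `c` scales the root by the inverse, so the
reflection is unchanged. -/
theorem affineRefl_eq_of_affineHyperplane_eq [Finite ι] {h h' : ι × ℤ}
    (H : P.affineHyperplane h'.1 h'.2 = P.affineHyperplane h.1 h.2) :
    P.affineRefl h' = P.affineRefl h := by
  have : IsAddTorsionFree M := IsAddTorsionFree.of_isTorsionFree ℝ M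
  have : IsAddTorsionFree N := IsAddTorsionFree.of_isTorsionFree ℝ N
  obtain ⟨c, hc0, hc⟩ := P.exists_eq_mul_of_affineHyperplane_eq H
  have hco : P.coroot h'.1 = c • P.coroot h.1 := by
    apply P.toLinearMap.flip.toPerfPair.injective
    rw [map_smul]
    ext x
    have h1 := hc x
    have h2 := hc 0
    simp only [affineValue, map_zero] at h1 h2
    change P.coroot' h'.1 x = c * P.coroot' h.1 x
    linarith
  have hroot := coroot_eq_smul_coroot_iff.1 hco
  refine P.affineWeylGroup_ext fun x => ?_
  rw [affineRefl_smul, affineRefl_smul, hc, hroot, smul_smul, mul_comm]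

/-- The action on root indices is faithful even if the roots do not span: if `w` fixes every index,
`w • x - x` lies in the root span and is killed by all coroots, hence is zero because the root form
is nondegenerate on that span. -/
theorem finite_weylGroup [Finite ι] : Finite P.weylGroup := by
  refine Finite.of_injective P.weylGroupToPerm ((injective_iff_map_eq_one _).2 fun w hw => ?_)
  refine P.weylGroup_ext fun x => ?_
  rw [one_smul, ← sub_eq_zero]
  have hspan : ∀ (w : P.weylGroup) (x : M), w • x - x ∈ P.rootSpan ℝ := by
    rintro ⟨w, hw⟩
    induction hw using weylGroup.induction with
    | mem j =>
      intro x
      change P.reflection j x - x ∈ _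
      rw [reflection_apply, sub_sub_cancel_left]
      exact neg_mem (Submodule.smul_mem _ _ (Submodule.subset_span (Set.mem_range_self j)))
    | one => intro x; change x - x ∈ _; simp
    | mul g₁ g₂ hg₁ hg₂ h₁ h₂ =>
      intro x
      have := add_mem (h₁ ((⟨g₂, hg₂⟩ : P.weylGroup) • x)) (h₂ x)
      rwa [sub_add_sub_cancel] at this
  have hmem := hspan w x
  have : Fintype ι := Fintype.ofFinite ι
  refine Submodule.disjoint_def.1 P.disjoint_rootSpan_ker_rootForm _ hmem ?_
  have hco : ∀ i, P.coroot' i (w • x - x) = 0 := fun i => by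
    have := P.coroot'_weylGroupToPerm_smul w i x
    rw [hw] at this
    rw [map_sub, sub_eq_zero]
    exact this
  rw [LinearMap.mem_ker]
  ext y
  rw [rootForm_apply_apply]
  simp only [hco]
  simp

/-! ### Walls and separating hyperplanes. -/

/-- The alcove containing the point `a`. -/
def alcoveOf (a : M) : Set M := {x | ∀ i k, P.StrictlySameSide i k x a}

/-- The affine functions defining the affine hyperplanes which strictly separate `x` from `a`. -/
def separating (a x : M) : Set (M → ℝ) :=
  {f | (∃ h, f = P.affineValue h) ∧ f x * f a < 0}

theorem finite_separating [Finite ι] (a x : M) : (P.separating a x).Finite := by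
  have hfin : (⋃ i : ι, (fun k : ℤ => P.affineValue (i, k)) ''
      Set.Icc ⌊min (P.coroot' i x) (P.coroot' i a)⌋
        ⌈max (P.coroot' i x) (P.coroot' i a)⌉).Finite :=
    Set.finite_iUnion fun i => (Set.finite_Icc _ _).image _
  refine hfin.subset ?_
  rintro _ ⟨⟨⟨i, k⟩, rfl⟩, hlt⟩
  refine Set.mem_iUnion.2 ⟨i, k, ?_, rfl⟩
  simp only [affineValue] at hlt
  have hk : min (P.coroot' i x) (P.coroot' i a) ≤ k ∧ k ≤ max (P.coroot' i x) (P.coroot' i a) := by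
    rw [min_le_iff, le_max_iff]
    constructor
    · by_contra! hc
      nlinarith [mul_pos (sub_pos.2 hc.1) (sub_pos.2 hc.2)]
    · by_contra! hc
      nlinarith [mul_pos (sub_pos.2 hc.1) (sub_pos.2 hc.2)]
  exact ⟨Int.cast_le.1 ((Int.floor_le _).trans hk.1),
    Int.cast_le.1 (hk.2.trans (Int.le_ceil _))⟩

variable {a : M}

theorem mem_alcoveOf_self (ha : ∀ h, P.affineValue h a ≠ 0) : a ∈ P.alcoveOf a :=
  fun i k => mul_self_pos.2 (ha (i, k))

/-- Reflecting in a wall crosses no other hyperplane: a point `p` in the face is fixed, and both `a`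
and its image lie on the same side as `p`. -/
theorem affineValue_mul_affineRefl_pos [P.IsCrystallographic]
    (ha : ∀ h, P.affineValue h a ≠ 0) {w h : ι × ℤ}
    (hw : P.IsWall (P.alcoveOf a) w.1 w.2)
    (hne : P.affineHyperplane h.1 h.2 ≠ P.affineHyperplane w.1 w.2) :
    0 < P.affineValue h (P.affineRefl w • a) * P.affineValue h a := by
  obtain ⟨p, hp, hside⟩ := hw
  rw [mem_affineHyperplane_iff] at hp
  have hfix : P.affineRefl w • p = p := by rw [affineRefl_smul, hp, zero_smul, sub_zero]
  obtain ⟨h', hh', -⟩ := P.exists_affineValue_smul (P.affineRefl w) h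
  have hh : ∀ x, P.affineValue h (P.affineRefl w • x) = P.affineValue h' x := fun x => by
    rw [← hh', affineRefl_smul_smul]
  have hne' : P.affineHyperplane h'.1 h'.2 ≠ P.affineHyperplane w.1 w.2 := by
    intro H
    obtain ⟨c, hc0, hc⟩ := P.exists_eq_mul_of_affineHyperplane_eq H
    refine hne (P.affineHyperplane_eq_of_eq_mul (c := -c) (neg_ne_zero.2 hc0) fun x => ?_)
    rw [← hh', hc, affineValue_affineRefl]
    ring
  have h1 : 0 < P.affineValue h p * P.affineValue h a :=
    hside _ _ hne a (P.mem_alcoveOf_self ha)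
  have h2 : 0 < P.affineValue h' p * P.affineValue h' a :=
    hside _ _ hne' a (P.mem_alcoveOf_self ha)
  rw [← hh, ← hh, hfix] at h2
  have h3 := mul_pos h1 h2
  have h4 : 0 < P.affineValue h p ^ 2 := by
    have : P.affineValue h p ≠ 0 := fun h0 => by simp [h0] at h1
    positivity
  refine pos_of_mul_pos_right (a := P.affineValue h p ^ 2) ?_ h4.le
  linarith

theorem ncard_separating_affineRefl_lt [Finite ι] [P.IsCrystallographic]
    (ha : ∀ h, P.affineValue h a ≠ 0) {w : ι × ℤ}
    (hw : P.IsWall (P.alcoveOf a) w.1 w.2) {x : M}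
    (hx : P.affineValue w x * P.affineValue w a < 0) :
    (P.separating a (P.affineRefl w • x)).ncard < (P.separating a x).ncard := by
  set s := P.affineRefl w with hs
  -- Precomposition with `s` sends functions separating `s • x` from `a` to functions separating `x`
  -- from `a`, and misses that of the wall itself.
  have hinj : Function.Injective (fun (f : M → ℝ) y => f (s • y)) := fun f g H => by
    ext y
    have := congrFun H (s • y)
    simpa only [hs, affineRefl_smul_smul] using this
  rw [← Set.ncard_image_of_injective _ hinj]
  refine Set.ncard_lt_ncard ⟨?_, fun hsub => ?_⟩ (P.finite_separating a x)
  · rintro _ ⟨_, ⟨⟨h, rfl⟩, hlt⟩, rfl⟩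
    obtain ⟨h', hh', -⟩ := P.exists_affineValue_smul s h
    have hh : ∀ y, P.affineValue h (s • y) = P.affineValue h' y := fun y => by
      rw [← hh', hs, affineRefl_smul_smul]
    refine ⟨⟨h', funext hh⟩, ?_⟩
    by_cases heq : P.affineHyperplane h.1 h.2 = P.affineHyperplane w.1 w.2
    · obtain ⟨c, hc0, hc⟩ := P.exists_eq_mul_of_affineHyperplane_eq heq
      rw [hc, hc, hs, affineValue_affineRefl] at hlt
      have : 0 < c ^ 2 := by positivity
      nlinarith
    · have hpos := P.affineValue_mul_affineRefl_pos ha hw heq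
      change P.affineValue h (s • x) * P.affineValue h (s • a) < 0
      have h4 : 0 < P.affineValue h a ^ 2 := by
        have := ha h
        positivity
      have := mul_neg_of_neg_of_pos hlt hpos
      by_contra! hc
      nlinarith [mul_nonneg hc h4.le]
  · obtain ⟨_, ⟨⟨h, rfl⟩, hlt⟩, hf⟩ := hsub ⟨⟨w, rfl⟩, hx⟩
    have hh : ∀ y, P.affineValue h y = -P.affineValue w y := fun y => by
      have := congrFun hf (s • y)
      simpa only [hs, affineRefl_smul_smul, affineValue_affineRefl] using this
    rw [hh, hh, hs, affineValue_affineRefl] at hlt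
    linarith

theorem exists_wall_separating [Finite ι] (ha : ∀ h, P.affineValue h a ≠ 0) {x : M}
    (hx : ∃ h, P.affineValue h x * P.affineValue h a < 0) :
    ∃ w : ι × ℤ, P.IsWall (P.alcoveOf a) w.1 w.2 ∧
      P.affineValue w x * P.affineValue w a < 0 := by
  have : Fintype ι := Fintype.ofFinite ι
  have hfl : ∀ i, (⌊P.coroot' i a⌋ : ℝ) < P.coroot' i a := fun i =>
    (Int.floor_le _).lt_of_ne fun h => ha (i, ⌊P.coroot' i a⌋) (sub_eq_zero.2 h.symm)
  have hcl : ∀ i, P.coroot' i a < ⌊P.coroot' i a⌋ + 1 := fun i => Int.lt_floor_add_one _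
  -- The alcove is cut out by finitely many inequalities: each coroot lies strictly between the
  -- consecutive integers around its value at `a`. `true` marks the lower bound, `false` the upper
  -- one.
  let m : ι × Bool → ι × ℤ := fun j =>
    (j.1, if j.2 then ⌊P.coroot' j.1 a⌋ else ⌊P.coroot' j.1 a⌋ + 1)
  let φ : ι × Bool → Module.Dual ℝ M := fun j => if j.2 then P.coroot' j.1 else -P.coroot' j.1
  let c : ι × Bool → ℝ := fun j => if j.2 then ⌊P.coroot' j.1 a⌋ else -(⌊P.coroot' j.1 a⌋ + 1)
  have hm : ∀ j, ∃ e : ℝ, e ≠ 0 ∧ (∀ y, φ j y - c j = e * P.affineValue (m j) y) := by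
    rintro ⟨i, _ | _⟩
    · refine ⟨-1, by norm_num, fun y => ?_⟩
      simp [φ, c, m, affineValue]
      ring
    · refine ⟨1, by norm_num, fun y => ?_⟩
      simp [φ, c, m, affineValue]
  have hca : ∀ j, c j < φ j a := by
    rintro ⟨i, _ | _⟩
    · simp [φ, c]
    · simpa [φ, c] using hfl i
  obtain ⟨j, -, hjx, p, hjp, hp⟩ := exists_facet_separating Finset.univ φ c
    (by
      rintro ⟨i, _ | _⟩ -
      · simpa [φ] using P.coroot'_ne_zero i
      · simpa [φ] using P.coroot'_ne_zero i)
    (a := a) (x := x)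
    (fun j _ => hca j)
    (by
      obtain ⟨⟨i, k⟩, hlt⟩ := hx
      simp only [affineValue] at hlt
      rcases mul_neg_iff.1 hlt with ⟨h1, h2⟩ | ⟨h1, h2⟩
      · refine ⟨(i, false), Finset.mem_univ _, ?_⟩
        have : ⌊P.coroot' i a⌋ + 1 ≤ k := Int.add_one_le_of_lt (Int.floor_lt.2 (by linarith))
        have : ((⌊P.coroot' i a⌋ : ℝ) + 1) ≤ k := by exact_mod_cast this
        simp only [φ, c, Bool.false_eq_true, if_false, LinearMap.neg_apply]
        linarith
      · refine ⟨(i, true), Finset.mem_univ _, ?_⟩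
        have : k ≤ ⌊P.coroot' i a⌋ := Int.le_floor.2 (by linarith)
        have : (k : ℝ) ≤ ⌊P.coroot' i a⌋ := by exact_mod_cast this
        simp only [φ, c, if_true]
        linarith)
  obtain ⟨e, he0, he⟩ := hm j
  have hpm : P.affineValue (m j) p = 0 := by
    have := he p
    rw [hjp, sub_self] at this
    exact (mul_eq_zero.1 this.symm).resolve_left he0
  refine ⟨m j, ⟨p, (P.mem_affineHyperplane_iff _ _).2 hpm, ?_⟩, ?_⟩
  · intro i k hne y hy
    have hle : ∀ l, c l ≤ φ l p := fun l => by
      rcases hp l (Finset.mem_univ _) with h | ⟨r, -, hr, hc⟩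
      · exact h.le
      · rw [hr, hc, LinearMap.smul_apply, hjp, smul_eq_mul]
    have hlt : ∀ l, P.affineHyperplane (m l).1 (m l).2 ≠ P.affineHyperplane (m j).1 (m j).2 →
        c l < φ l p := fun l hl => by
      refine (hp l (Finset.mem_univ _)).resolve_right ?_
      rintro ⟨r, hr0, hr, hc⟩
      obtain ⟨e', he'0, he'⟩ := hm l
      refine hl (P.affineHyperplane_eq_of_eq_mul (c := e'⁻¹ * r * e)
        (mul_ne_zero (mul_ne_zero (inv_ne_zero he'0) hr0) he0) fun y => ?_)
      have h1 := he' y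
      have h2 := he y
      rw [hr, hc, LinearMap.smul_apply, smul_eq_mul, ← mul_sub, h2] at h1
      field_simp
      linarith
    -- Only the two levels adjacent to `a` need strict bounds at `p`; for every other level the weak
    -- bounds suffice.
    have hpa : 0 < (P.coroot' i p - k) * (P.coroot' i a - k) := by
      have h1 := hle (i, true)
      have h2 := hle (i, false)
      simp only [φ, c, Bool.false_eq_true, if_false, if_true, LinearMap.neg_apply] at h1 h2
      have h3 := hfl i
      have h4 := hcl i
      rcases lt_trichotomy k ⌊P.coroot' i a⌋ with hk | hk | hk
      · have : (k : ℝ) < ⌊P.coroot' i a⌋ := by exact_mod_cast hk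
        exact mul_pos (by linarith) (by linarith)
      · have := hlt (i, true) (by
          change P.affineHyperplane i ⌊P.coroot' i a⌋ ≠ _
          rwa [← hk])
        simp only [φ, c, if_true, ← hk] at this h3
        exact mul_pos (by linarith) (by linarith)
      · rcases (Int.add_one_le_of_lt hk).eq_or_lt with hk | hk
        · have := hlt (i, false) (by
            change P.affineHyperplane i (⌊P.coroot' i a⌋ + 1) ≠ _
            rwa [hk])
          have hk' : (⌊P.coroot' i a⌋ : ℝ) + 1 = k := by exact_mod_cast hk
          simp only [φ, c, Bool.false_eq_true, if_false, LinearMap.neg_apply] at this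
          exact mul_pos_of_neg_of_neg (by linarith) (by linarith)
        · have : (⌊P.coroot' i a⌋ : ℝ) + 1 < k := by exact_mod_cast hk
          exact mul_pos_of_neg_of_neg (by linarith) (by linarith)
    have hya : 0 < (P.coroot' i y - k) * (P.coroot' i a - k) := hy i k
    change 0 < (P.coroot' i p - k) * (P.coroot' i y - k)
    rcases mul_pos_iff.1 hpa with ⟨h1, h2⟩ | ⟨h1, h2⟩
    · exact mul_pos h1 (pos_of_mul_pos_left hya h2.le)
    · exact mul_pos_of_neg_of_neg h1 (by nlinarith)
  · have h1 := he x
    have h2 := he a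
    have h3 : (φ j x - c j) * (φ j a - c j) < 0 :=
      mul_neg_of_neg_of_pos (by linarith) (by linarith [hca j])
    rw [h1, h2] at h3
    have : 0 < e ^ 2 := by positivity
    by_contra! hc
    nlinarith [mul_nonneg this.le hc]

theorem affineRefl_mem_closure_wallReflections {C : Set M} {w : ι × ℤ}
    (hw : P.IsWall C w.1 w.2) : P.affineRefl w ∈ Subgroup.closure (P.wallReflections C) :=
  Subgroup.subset_closure ⟨w.1, w.2, hw, rfl⟩

/-- Every point can be moved into the closed alcove by wall reflections. -/
theorem exists_smul_mem_closed_alcove [Finite ι] [P.IsCrystallographic]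
    (ha : ∀ h, P.affineValue h a ≠ 0) (x : M) :
    ∃ g ∈ Subgroup.closure (P.wallReflections (P.alcoveOf a)),
      ∀ h, 0 ≤ P.affineValue h (g • x) * P.affineValue h a := by
  induction hn : (P.separating a x).ncard using Nat.strong_induction_on generalizing x with
  | _ n ih =>
    by_cases hx : ∃ h, P.affineValue h x * P.affineValue h a < 0
    · obtain ⟨w, hw, hlt⟩ := P.exists_wall_separating ha hx
      obtain ⟨g, hg, hgx⟩ := ih _ (hn ▸ P.ncard_separating_affineRefl_lt ha hw hlt) _ rfl
      refine ⟨g * P.affineRefl w, mul_mem hg (P.affineRefl_mem_closure_wallReflections hw), ?_⟩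
      simpa only [mul_smul] using hgx
    · push Not at hx
      exact ⟨1, one_mem _, by simpa only [one_smul] using hx⟩

/-! ### The exchange property and generation by wall reflections. -/

theorem affineValue_smul_ne_zero [P.IsCrystallographic] (ha : ∀ h, P.affineValue h a ≠ 0)
    (g : P.AffineWeylGroup) (h : ι × ℤ) : P.affineValue h (g • a) ≠ 0 := by
  obtain ⟨h', hh', -⟩ := P.exists_affineValue_smul g⁻¹ h
  rw [← hh', inv_smul_smul]
  exact ha h'

/-- The exchange property. -/
theorem exists_affineRefl_mul_prod_eq [Finite ι] [P.IsCrystallographic]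
    (ha : ∀ h, P.affineValue h a ≠ 0) {h : ι × ℤ} (l : List P.AffineWeylGroup)
    (hl : ∀ s ∈ l, s ∈ P.wallReflections (P.alcoveOf a))
    (hlt : P.affineValue h (l.prod • a) * P.affineValue h a < 0) :
    ∃ l' : List P.AffineWeylGroup, (∀ s ∈ l', s ∈ P.wallReflections (P.alcoveOf a)) ∧
      l'.length < l.length ∧ P.affineRefl h * l.prod = l'.prod := by
  induction l using List.reverseRecOn with
  | nil =>
    rw [List.prod_nil, one_smul] at hlt
    exact absurd (mul_self_nonneg _) (not_le.2 hlt)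
  | append_singleton l t ih =>
    have hl' : ∀ s ∈ l, s ∈ P.wallReflections (P.alcoveOf a) := fun s hs => hl s (by simp [hs])
    have ht := hl t (by simp)
    by_cases hneg : P.affineValue h (l.prod • a) * P.affineValue h a < 0
    · obtain ⟨l', h1, h2, h3⟩ := ih hl' hneg
      refine ⟨l' ++ [t], ?_, by simpa using h2, by simp [← mul_assoc, h3]⟩
      intro s hs
      rcases List.mem_append.1 hs with hs | hs
      · exact h1 s hs
      · rw [List.mem_singleton.1 hs]
        exact ht
    · obtain ⟨i, k, hw, rfl⟩ := ht
      refine ⟨l, hl', by simp, ?_⟩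
      set u := l.prod
      have htw : P.affineReflection i k = P.affineRefl (i, k) := rfl
      have hlt' : P.affineValue h (u • P.affineRefl (i, k) • a) * P.affineValue h a < 0 := by
        rwa [List.prod_append, List.prod_singleton, mul_smul] at hlt
      have hne := P.affineValue_smul_ne_zero ha u h
      have hpos : 0 < P.affineValue h (u • a) * P.affineValue h a :=
        (not_lt.1 hneg).lt_of_ne' (mul_ne_zero hne (ha h))
      obtain ⟨h', hh', hconj⟩ := P.exists_affineValue_smul u⁻¹ h
      have hh : ∀ x, P.affineValue h (u • x) = P.affineValue h' x := fun x => by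
        rw [← hh', inv_smul_smul]
      rw [hh] at hlt' hpos
      -- The last letter makes the crossing, so `u⁻¹` carries the hyperplane to its wall; the
      -- reflection is then the conjugate of that letter by `u`, and the letter cancels.
      have heq : P.affineHyperplane h'.1 h'.2 = P.affineHyperplane i k := by
        by_contra hc
        have h1 := P.affineValue_mul_affineRefl_pos ha (w := (i, k)) hw hc
        have h2 := mul_pos h1 hpos
        have h3 : 0 < P.affineValue h' a ^ 2 := by
          have := ha h'
          positivity
        nlinarith [mul_neg_of_neg_of_pos hlt' h3]
      rw [P.affineRefl_eq_of_affineHyperplane_eq (h := (i, k)) heq, inv_inv] at hconj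
      rw [List.prod_append, List.prod_singleton, htw, ← hconj]
      calc P.affineRefl h * (u * (u⁻¹ * P.affineRefl h * u))
          = (P.affineRefl h * P.affineRefl h) * u := by group
        _ = u := by rw [affineRefl_mul_self, one_mul]

/-- If the word starts with `t`, the rest moves `a` across the wall of `t`, so exchange shortens the
word. -/
theorem prod_eq_one_of_smul_mem_alcove [Finite ι] [P.IsCrystallographic]
    (ha : ∀ h, P.affineValue h a ≠ 0) (l : List P.AffineWeylGroup)
    (hl : ∀ s ∈ l, s ∈ P.wallReflections (P.alcoveOf a))
    (hpos : ∀ h, 0 < P.affineValue h (l.prod • a) * P.affineValue h a) : l.prod = 1 := by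
  induction hn : l.length using Nat.strong_induction_on generalizing l with
  | _ n ih =>
    rcases l with _ | ⟨t, l⟩
    · rfl
    · obtain ⟨i, k, hw, ht⟩ := hl t (by simp)
      replace ht : t = P.affineRefl (i, k) := ht
      have h1 := hpos (i, k)
      rw [List.prod_cons, ht, mul_smul, affineValue_affineRefl] at h1
      obtain ⟨l', hl', hlen, hprod⟩ := P.exists_affineRefl_mul_prod_eq ha (h := (i, k)) l
        (fun s hs => hl s (by simp [hs])) (by linarith)
      rw [List.prod_cons, ht, hprod]
      refine ih l'.length ?_ l' hl' (fun h => ?_) rfl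
      · rw [← hn, List.length_cons]
        lia
      · rw [← hprod, ← ht, ← List.prod_cons]
        exact hpos h

theorem exists_list_of_mem_closure_wallReflections {C : Set M} {g : P.AffineWeylGroup}
    (hg : g ∈ Subgroup.closure (P.wallReflections C)) :
    ∃ l : List P.AffineWeylGroup, (∀ s ∈ l, s ∈ P.wallReflections C) ∧ l.prod = g := by
  rw [← Subgroup.mem_toSubmonoid, Subgroup.closure_toSubmonoid] at hg
  obtain ⟨l, hl, rfl⟩ := Submonoid.exists_list_of_mem_closure hg
  refine ⟨l, fun s hs => (hl s hs).elim id fun h => ?_, rfl⟩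
  obtain ⟨i, k, hw, heq⟩ := h
  refine ⟨i, k, hw, ?_⟩
  rw [inv_eq_iff_eq_inv] at heq
  rw [heq, inv_eq_iff_mul_eq_one]
  exact P.affineRefl_mul_self (i, k)

/-- Each such condition excludes one value of `t`, so only countably many are excluded. -/
theorem exists_forall_coroot'_add_smul_ne [Finite ι] (x u : M) :
    ∃ t : ℝ, ∀ j (l : ℤ), P.coroot' j u ≠ 0 → P.coroot' j (x + t • u) ≠ l := by
  have hc : (Set.range fun q : ι × ℤ => (q.2 - P.coroot' q.1 x) / P.coroot' q.1 u).Countable :=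
    Set.countable_range _
  obtain ⟨t, ht⟩ := (hc.dense_compl ℝ).nonempty
  refine ⟨t, fun j l hj heq => ht ⟨(j, l), ?_⟩⟩
  rw [map_add, map_smul, smul_eq_mul] at heq
  simp only
  rw [← heq]
  field_simp
  ring

theorem exists_affineValue_ne_zero [Finite ι] : ∃ a : M, ∀ h, P.affineValue h a ≠ 0 := by
  obtain ⟨u, hu⟩ := Module.Dual.exists_forall_ne_zero_of_forall_exists P.coroot' fun i => by
    by_contra! hc
    exact P.coroot'_ne_zero i (LinearMap.ext hc)
  obtain ⟨t, ht⟩ := P.exists_forall_coroot'_add_smul_ne 0 u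
  exact ⟨0 + t • u, fun h => sub_ne_zero.2 (ht h.1 h.2 (hu h.1))⟩

/-- Some point of an affine hyperplane lies on no other affine hyperplane. -/
theorem exists_generic_mem_affineHyperplane [Finite ι] (h : ι × ℤ) :
    ∃ p, P.affineValue h p = 0 ∧ ∀ h', P.affineValue h' p = 0 →
      P.affineHyperplane h'.1 h'.2 = P.affineHyperplane h.1 h.2 := by
  obtain ⟨u, hu, hne⟩ := Module.Dual.exists_forall_mem_ne_zero_of_forall_exists
    (LinearMap.ker (P.coroot' h.1))
    (fun j : {j // ∃ x ∈ LinearMap.ker (P.coroot' h.1), P.coroot' j x ≠ 0} => P.coroot' j.1)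
    (fun j => j.2)
  rw [LinearMap.mem_ker] at hu
  obtain ⟨t, ht⟩ := P.exists_forall_coroot'_add_smul_ne (((h.2 : ℝ) / 2) • P.root h.1) u
  have hp : P.affineValue h (((h.2 : ℝ) / 2) • P.root h.1 + t • u) = 0 := by
    rw [affineValue, map_add, map_smul, map_smul, hu]
    simp
  refine ⟨_, hp, fun h' hp' => ?_⟩
  by_cases hj : ∃ x ∈ LinearMap.ker (P.coroot' h.1), P.coroot' h'.1 x ≠ 0
  · exact absurd (sub_eq_zero.1 hp') (ht h'.1 h'.2 (hne ⟨h'.1, hj⟩))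
  · push Not at hj
    obtain ⟨c, hc⟩ := Module.Dual.exists_eq_smul_of_ker_le (P.coroot'_ne_zero h.1) hj
    have hc0 : c ≠ 0 := by
      rintro rfl
      exact P.coroot'_ne_zero h'.1 (by simpa using hc)
    refine P.affineHyperplane_eq_of_eq_mul hc0 fun x => ?_
    simp only [affineValue, hc, LinearMap.smul_apply, smul_eq_mul] at hp hp' ⊢
    linear_combination hp' - c * hp

/-- A generic point of the hyperplane can be moved into the closed alcove by wall reflections. The
image hyperplane is then the only one through the image point, hence a wall, and conjugating back
gives the reflection. -/
theorem affineRefl_mem_closure [Finite ι] [P.IsCrystallographic]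
    (ha : ∀ h, P.affineValue h a ≠ 0) (h : ι × ℤ) :
    P.affineRefl h ∈ Subgroup.closure (P.wallReflections (P.alcoveOf a)) := by
  obtain ⟨p, hp, hgen⟩ := P.exists_generic_mem_affineHyperplane h
  obtain ⟨g, hg, hgp⟩ := P.exists_smul_mem_closed_alcove ha p
  obtain ⟨h', hh', hconj⟩ := P.exists_affineValue_smul g h
  have hwall : P.IsWall (P.alcoveOf a) h'.1 h'.2 := by
    refine ⟨g • p, (P.mem_affineHyperplane_iff _ _).2 ((hh' p).trans hp), fun j l hne y hy => ?_⟩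
    have hne0 : P.affineValue (j, l) (g • p) ≠ 0 := by
      intro h0
      apply hne
      obtain ⟨h'', hh'', -⟩ := P.exists_affineValue_smul g⁻¹ (j, l)
      have heq := hgen h'' (by rw [← inv_smul_smul g p, hh'', h0])
      obtain ⟨c, hc0, hc⟩ := P.exists_eq_mul_of_affineHyperplane_eq heq
      refine P.affineHyperplane_eq_of_eq_mul (h' := (j, l)) hc0 fun x => ?_
      rw [← hh'', hc, ← hh', smul_inv_smul]
    have h1 : 0 < P.affineValue (j, l) (g • p) * P.affineValue (j, l) a :=
      (hgp _).lt_of_ne' (mul_ne_zero hne0 (ha _))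
    have h2 : 0 < P.affineValue (j, l) y * P.affineValue (j, l) a := hy j l
    change 0 < P.affineValue (j, l) (g • p) * P.affineValue (j, l) y
    rcases mul_pos_iff.1 h1 with ⟨h3, h4⟩ | ⟨h3, h4⟩
    · exact mul_pos h3 (pos_of_mul_pos_left h2 h4.le)
    · exact mul_pos_of_neg_of_neg h3 (by nlinarith)
  have hmem := P.affineRefl_mem_closure_wallReflections hwall
  rw [← hconj] at hmem
  have := mul_mem (mul_mem (inv_mem hg) hmem) hg
  simpa [mul_assoc] using this

/-- The affine Weyl group is generated by the affine reflections. -/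
theorem mem_of_forall_affineRefl_mem {H : Subgroup P.AffineWeylGroup}
    (hH : ∀ h, P.affineRefl h ∈ H) (g : P.AffineWeylGroup) : g ∈ H := by
  have hr : ∀ w : P.weylGroup, (SemidirectProduct.inr w : P.AffineWeylGroup) ∈ H := by
    rintro ⟨w, hw⟩
    induction hw using weylGroup.induction with
    | mem i =>
      convert hH (i, 0) using 1
      refine SemidirectProduct.ext (Subtype.ext ?_) rfl
      exact (zero_smul ℤ (P.root i)).symm
    | one => exact one_mem H
    | mul g₁ g₂ hg₁ hg₂ h₁ h₂ =>
      have := mul_mem h₁ h₂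
      rwa [← map_mul] at this
  have hl : ∀ x (hx : x ∈ P.rootLattice),
      (SemidirectProduct.inl (Multiplicative.ofAdd ⟨x, hx⟩) : P.AffineWeylGroup) ∈ H := by
    intro x hx
    induction hx using AddSubgroup.closure_induction with
    | mem x hx =>
      obtain ⟨i, rfl⟩ := hx
      -- Two parallel reflections at levels 1 and 0 compose to the translation by the root.
      convert mul_mem (hH (i, 1)) (hH (i, 0)) using 1
      refine P.affineWeylGroup_ext fun y => ?_
      rw [mul_smul, affineRefl_smul (h := (i, 0)), affineRefl_smul, affineWeyl_smul_def]
      simp [affineValue]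
      module
    | zero => exact one_mem H
    | add x y hx hy h₁ h₂ =>
      have := mul_mem h₁ h₂
      rwa [← map_mul] at this
    | neg x hx h₁ =>
      have := inv_mem h₁
      rwa [← map_inv] at this
  rw [← SemidirectProduct.inl_left_mul_inr_right g]
  exact mul_mem (hl _ g.left.toAdd.2) (hr _)

theorem eq_one_of_smul_mem_alcove [Finite ι] [P.IsCrystallographic]
    (ha : ∀ h, P.affineValue h a ≠ 0) {g : P.AffineWeylGroup}
    (hpos : ∀ h, 0 < P.affineValue h (g • a) * P.affineValue h a) : g = 1 := by
  obtain ⟨l, hl, rfl⟩ := P.exists_list_of_mem_closure_wallReflections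
    (P.mem_of_forall_affineRefl_mem (P.affineRefl_mem_closure ha) g)
  exact P.prod_eq_one_of_smul_mem_alcove ha l hl hpos

/-! ### Stabilizers of points. -/

/-- The stabilizer of a point of the closed alcove is generated by the wall reflections in it. -/
theorem mem_closure_of_smul_eq [Finite ι] [P.IsCrystallographic]
    (ha : ∀ h, P.affineValue h a ≠ 0) {x : M}
    (hx : ∀ h, 0 ≤ P.affineValue h x * P.affineValue h a)
    (g : P.AffineWeylGroup) (hg : g • x = x) :
    g ∈ Subgroup.closure {s | s ∈ P.wallReflections (P.alcoveOf a) ∧ s • x = x} := by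
  induction hn : (P.separating a (g • a)).ncard using Nat.strong_induction_on generalizing g with
  | _ n ih =>
    by_cases hsep : ∃ h, P.affineValue h (g • a) * P.affineValue h a < 0
    · obtain ⟨w, hw, hlt⟩ := P.exists_wall_separating ha hsep
      -- As `g` fixes `x`, the point `x` lies in the closures of both the alcove and its image,
      -- which `w` separates.
      have hwx : P.affineValue w x = 0 := by
        obtain ⟨w', hw', -⟩ := P.exists_affineValue_smul g⁻¹ w
        have h1 := hx w
        have h2 := hx w'
        have h3 : g⁻¹ • x = x := inv_smul_eq_iff.2 hg.symm
        rw [← h3, hw', ← inv_smul_smul g a, hw'] at h2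
        by_contra hne
        have h4 : 0 < P.affineValue w x ^ 2 := by positivity
        nlinarith [mul_nonneg h1 h2, mul_neg_of_pos_of_neg h4 hlt]
      have hfix : P.affineRefl w • x = x := by rw [affineRefl_smul, hwx, zero_smul, sub_zero]
      have hmem := ih _ (hn ▸ P.ncard_separating_affineRefl_lt ha hw hlt) (P.affineRefl w * g)
        (by rw [mul_smul, hg, hfix]) (by rw [mul_smul])
      have hs : P.affineRefl w ∈ Subgroup.closure
          {s | s ∈ P.wallReflections (P.alcoveOf a) ∧ s • x = x} :=
        Subgroup.subset_closure ⟨⟨w.1, w.2, hw, rfl⟩, hfix⟩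
      have := mul_mem hs hmem
      rwa [← mul_assoc, affineRefl_mul_self, one_mul] at this
    · push Not at hsep
      rw [P.eq_one_of_smul_mem_alcove ha fun h => (hsep h).lt_of_ne'
        (mul_ne_zero (P.affineValue_smul_ne_zero ha g h) (ha h))]
      exact one_mem _

/-- The stabilizer of any point is conjugate to a subgroup generated by wall reflections of a
given alcove, in such a way that these reflections correspond to elements of the stabilizer. -/
theorem exists_stabilizer_eq_map_conj [Finite ι] [P.IsCrystallographic]
    (ha : ∀ h, P.affineValue h a ≠ 0) (v : M) :
    ∃ g : P.AffineWeylGroup, MulAction.stabilizer P.AffineWeylGroup v =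
      (Subgroup.closure {s | s ∈ P.wallReflections (P.alcoveOf a) ∧
        (g * s * g⁻¹) • v = v}).map (MulAut.conj g).toMonoidHom := by
  obtain ⟨g, -, hg⟩ := P.exists_smul_mem_closed_alcove ha v
  have hset : ∀ s : P.AffineWeylGroup, (g⁻¹ * s * g⁻¹⁻¹) • v = v ↔ s • g • v = g • v := fun s => by
    rw [inv_inv, mul_smul, mul_smul, inv_smul_eq_iff]
  refine ⟨g⁻¹, le_antisymm (fun y hy => ?_) ?_⟩
  · refine ⟨g * y * g⁻¹, ?_, by simp [mul_assoc]⟩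
    simp only [hset]
    refine P.mem_closure_of_smul_eq ha hg _ ?_
    rw [mul_smul, mul_smul, inv_smul_smul, MulAction.mem_stabilizer_iff.1 hy]
  · rw [Subgroup.map_le_iff_le_comap, Subgroup.closure_le]
    rintro s ⟨-, hs⟩
    exact hs

/-- The linear part identifies the stabilizer of a point with the congruence subgroup. -/
def congruenceSubgroupEquiv (v : M) :
    P.congruenceSubgroup v ≃* MulAction.stabilizer P.AffineWeylGroup v where
  toFun ρ := ⟨⟨Multiplicative.ofAdd ⟨v - (ρ : P.weylGroup) • v, by
      rw [← neg_sub]; exact neg_mem ρ.2⟩, ρ⟩, by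
    rw [MulAction.mem_stabilizer_iff, affineWeyl_smul_def]
    exact add_sub_cancel _ _⟩
  invFun g := ⟨(g : P.AffineWeylGroup).right, by
    have h := MulAction.mem_stabilizer_iff.1 g.2
    rw [affineWeyl_smul_def] at h
    change (g : P.AffineWeylGroup).right • v - v ∈ P.rootLattice
    have h' : (g : P.AffineWeylGroup).right • v - v =
        -((g : P.AffineWeylGroup).left.toAdd : M) := by
      rw [sub_eq_iff_eq_add, ← sub_eq_neg_add]
      exact eq_sub_of_add_eq h
    rw [h']
    exact neg_mem (SetLike.coe_mem _)⟩
  left_inv ρ := rfl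
  right_inv g := by
    refine Subtype.ext (SemidirectProduct.ext (Subtype.ext ?_) rfl)
    have h := MulAction.mem_stabilizer_iff.1 g.2
    rw [affineWeyl_smul_def] at h
    exact sub_eq_of_eq_add' h.symm
  map_mul' ρ σ := by
    refine Subtype.ext (SemidirectProduct.ext (Subtype.ext ?_) rfl)
    change v - ((ρ : P.weylGroup) * (σ : P.weylGroup)) • v =
      (v - (ρ : P.weylGroup) • v) + (ρ : P.weylGroup) • (v - (σ : P.weylGroup) • v)
    rw [mul_smul, smul_sub]
    abel

end RootPairing

theorem corollary2p2 {ι M N : Type*} [Finite ι] [AddCommGroup M] [Module ℝ M]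
    [AddCommGroup N] [Module ℝ N] (P : RootPairing ι ℝ M N) [P.IsCrystallographic]
    (v : M) (hv : v ∈ Submodule.span ℝ (P.rootLattice : Set M)) :
    (∃ e : P.congruenceSubgroup v ≃* MulAction.stabilizer P.AffineWeylGroup v,
      ∀ ρ : P.congruenceSubgroup v,
        (e ρ : P.AffineWeylGroup).right = (ρ : P.weylGroup)) ∧
    Finite (MulAction.stabilizer P.AffineWeylGroup v) ∧
    MulAction.stabilizer P.AffineWeylGroup v =
      Subgroup.closure {s | s ∈ MulAction.stabilizer P.AffineWeylGroup v ∧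
        ∃ i k, s = P.affineReflection i k} ∧
    (∃ C : Set M, P.IsAlcove C) ∧
    ∀ C : Set M, P.IsAlcove C →
      P.IsParabolic C (MulAction.stabilizer P.AffineWeylGroup v) := by
  refine ⟨⟨P.congruenceSubgroupEquiv v, fun ρ => rfl⟩, ?_, ?_, ?_, ?_⟩
  · have := P.finite_weylGroup
    exact Finite.of_equiv _ (P.congruenceSubgroupEquiv v).toEquiv
  · obtain ⟨a, ha⟩ := P.exists_affineValue_ne_zero
    obtain ⟨g, hg⟩ := P.exists_stabilizer_eq_map_conj ha v
    refine le_antisymm ?_ ((Subgroup.closure_le _).2 fun s hs => hs.1)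
    rw [hg, Subgroup.map_le_iff_le_comap, Subgroup.closure_le, ← hg]
    -- The generators are conjugates of wall reflections, hence affine reflections themselves.
    rintro s ⟨⟨i, k, -, rfl⟩, hs⟩
    obtain ⟨h, -, hh⟩ := P.exists_affineValue_smul g (i, k)
    exact Subgroup.subset_closure ⟨hs, h.1, h.2, hh⟩
  · obtain ⟨a, ha⟩ := P.exists_affineValue_ne_zero
    exact ⟨P.alcoveOf a, a, fun i k h => ha (i, k) ((P.mem_affineHyperplane_iff (i, k) a).1 h), rfl⟩
  · rintro _ ⟨a, ha, rfl⟩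
    obtain ⟨g, hg⟩ := P.exists_stabilizer_eq_map_conj (a := a)
      (fun h h0 => ha h.1 h.2 ((P.mem_affineHyperplane_iff h a).2 h0)) v
    exact ⟨_, fun s hs => hs.1, g, hg⟩

end
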